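/- Let $\mathcal G=(V,\mathcal E)$ be a finite connected undirected graph without loops or multiple edges, let $\mathcal A$ be its set of arcs (each edge $\overline{vw}$ gives the two arcs $v\to w$ and $w\to v$), let $k$ be a field, and let $k[P_a : a\in\mathcal A]$ be the polynomial ring with one variable for each arc. A closed trajectory is a walk $\omega=v_0v_1\cdots v_{n-1}v_0$ in $\mathcal G$, $r\omega$ is the reversed walk, and $P^\omega=\prod_{a\in\mathcal A}P_a^{N_a(\omega)}$, where $N_a(\omega)$ is the number of times $\omega$ traverses the arc $a$. A cycle is a closed trajectory with at least three distinct vertices that meets no vertex twice, except that it ends at its initial vertex. The K-ideal (Kolmogorov's ideal) of $\mathcal G$ is the ideal of $k[P_a : a\in\mathcal A]$ generated by the binomials $P^\omega-P^{r\omega}$, where $\omega$ runs over all closed trajectories. The cocycle matrix $M$ of $\mathcal G$ is the integer matrix with columns indexed by $\mathcal A$ and rows indexed by $\mathcal E\sqcup\mathcal S$, where $\mathcal S$ is the set of all $B$ with $\emptyset\neq B\subsetneq V$. Its entry at $(e,a)$, $e\in\mathcal E$, is $1$ if $a$ is one of the two directions of $e$, and $0$ otherwise; its entry at $(B,a)$,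 $B\in\mathcal S$, is $u_a(B)=1$ if $a$ exits from $B$, $u_a(B)=-1$ if $a$ enters into $B$, and $u_a(B)=0$ otherwise. The toric ideal of $M$ is the kernel of the $k$-algebra homomorphism from $k[P_a : a\in\mathcal A]$ to the Laurent polynomial ring $k[s_e^{\pm1}, t_B^{\pm1} : e\in\mathcal E,\ B\in\mathcal S]$ defined by $$P_{a}\mapsto s_{e(a)}\prod_{B\in\mathcal S}t_B^{u_a(B)},$$ where $e(a)$ is the edge of $a$. For $z,z'\in\mathbb Z^{\mathcal A}$ write $z'\sqsubseteq z$ if $z'_az_a\ge 0$ and $|z'_a|\le|z_a|$ for all $a\in\mathcal A$. The Graver basis of a subset $L\subseteq\mathbb Z^{\mathcal A}$ is the set of the $\sqsubseteq$-minimal elements of $L\setminus\{0\}$. The Graver basis of an ideal $I$ of $k[P_a : a\in\mathcal A]$ is the set of binomials $P^{z^+}-P^{z^-}$, where $z$ runs over the Graver basis of $\{z\in\mathbb Z^{\mathcal A} : P^{z^+}-P^{z^-}\in I\}$. Then: 1. the K-ideal of $\mathcal G$ is equal to the toric ideal of the cocycle matrix $M$; 2. the binomials $P^\omega-P^{r\omega}$,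 $\omega$ a cycle, generate the K-ideal, and the set of these binomials is the Graver basis of the K-ideal; it is also the set of all binomials $P^{z^+}-P^{z^-}$ with $z$ in the Graver basis of the lattice $\{z\in\mathbb Z^{\mathcal A} : Mz=0\}$. -/

import Mathlib

open scoped Matrix

namespace KIdeal

noncomputable section

/-! ### Integer vectors, binomials, toric ideals, Graver bases -/

section General

variable {σ : Type*}

/-- Conformity: `z₁ ⊑ z₂` if `z₁` and `z₂` are sign compatible and `|z₁| ≤ |z₂|` componentwise. -/
def Conformal (z₁ z₂ : σ → ℤ) : Prop :=
  ∀ a, 0 ≤ z₁ a * z₂ a ∧ |z₁ a| ≤ |z₂ a|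

/-- The Graver basis of a set `L` of integer vectors (typically a lattice): the nonzero elements
of `L` that are minimal, among the nonzero elements of `L`, for the conformity order. -/
def graverVectors (L : Set (σ → ℤ)) : Set (σ → ℤ) :=
  {z | z ∈ L ∧ z ≠ 0 ∧ ∀ z' ∈ L, z' ≠ 0 → Conformal z' z → z' = z}

/-- The integer kernel (the lattice) of an integer matrix. -/
def kernelLattice [Fintype σ] {ρ : Type*} (M : Matrix ρ σ ℤ) : Set (σ → ℤ) :=
  {z | M *ᵥ z = 0}

/-- The pure binomial `x ^ (z⁺) - x ^ (z⁻)` of an integer vector `z`. -/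
def vectorBinomial (k : Type*) [CommRing k] [Fintype σ] (z : σ → ℤ) : MvPolynomial σ k :=
  ∏ a, MvPolynomial.X a ^ (z a).toNat - ∏ a, MvPolynomial.X a ^ (-(z a)).toNat

/-- The Graver basis of an ideal: its primitive binomials, that is, the binomials
`x ^ (z⁺) - x ^ (z⁻)` with `z ≠ 0` that lie in the ideal and whose vector `z` is minimal for the
conformity order among all nonzero vectors with this property. -/
def graverBasis {k : Type*} [CommRing k] [Fintype σ] (I : Ideal (MvPolynomial σ k)) :
    Set (MvPolynomial σ k) :=
  vectorBinomial k '' graverVectors {z | vectorBinomial k z ∈ I}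

/-- The monomial homomorphism of an integer matrix `M`: the variable of the column `a` goes to the
Laurent monomial `∏ r, t_r ^ (M r a)`. The group algebra of `ρ → ℤ` is (for a finite set `ρ` of
rows) the ring of Laurent polynomials in the variables `t_r`, `r ∈ ρ`. -/
def monomialHom (k : Type*) [CommRing k] {ρ : Type*} (M : Matrix ρ σ ℤ) :
    MvPolynomial σ k →ₐ[k] AddMonoidAlgebra k (ρ → ℤ) :=
  MvPolynomial.aeval fun a => AddMonoidAlgebra.single (fun r => M r a) (1 : k)

/-- The toric ideal of an integer matrix: the kernel of its monomial homomorphism. -/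
def toricIdeal (k : Type*) [CommRing k] {ρ : Type*} (M : Matrix ρ σ ℤ) :
    Ideal (MvPolynomial σ k) :=
  RingHom.ker (monomialHom k M)

end General

/-! ### Closed trajectories, the K-ideal and the cocycle matrix of a graph -/

section Graph

variable {V : Type*} (k : Type*) [CommRing k] (G : SimpleGraph V)

variable {G} in
/-- The monomial `P ^ ω`, the product of the variables `P_a` over the arcs `a` traversed by the
trajectory `ω`, with multiplicity. Arcs are the darts (oriented edges) of the graph. -/
def walkMonomial {u v : V} (ω : G.Walk u v) : MvPolynomial G.Dart k :=
  (ω.darts.map MvPolynomial.X).prod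

variable {G} in
/-- The binomial `P ^ ω - P ^ (rω)` of a closed trajectory `ω`. -/
def walkBinomial {v : V} (ω : G.Walk v v) : MvPolynomial G.Dart k :=
  walkMonomial k ω - walkMonomial k ω.reverse

/-- Kolmogorov's ideal: generated by the binomials of all closed trajectories. -/
def kIdeal : Ideal (MvPolynomial G.Dart k) :=
  Ideal.span {f | ∃ (v : V) (ω : G.Walk v v), f = walkBinomial k ω}

/-- The binomials of the cycles: `ω` runs over the closed trajectories with at least three
distinct vertices that meet no vertex twice except the initial one at the end. (Elementary closed
trajectories `v w v` have the binomial `0`.) -/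
def cycleBinomials : Set (MvPolynomial G.Dart k) :=
  {f | ∃ (v : V) (ω : G.Walk v v), ω.IsCycle ∧ f = walkBinomial k ω}

/-- The proper nonempty sets of vertices. -/
abbrev ProperSubset (V : Type*) : Type _ := {B : Set V // B.Nonempty ∧ B ≠ Set.univ}

open Classical in
variable {G} in
/-- The cocycle vector of `B`: `1` on arcs that exit from `B`, `-1` on arcs that enter into `B`,
`0` elsewhere. -/
def cocycleVector (B : Set V) (a : G.Dart) : ℤ :=
  if a.fst ∈ B ∧ a.snd ∉ B then 1 else if a.fst ∉ B ∧ a.snd ∈ B then -1 else 0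

open Classical in
/-- The cocycle matrix: columns are the arcs, rows are the edges (incidence of arcs with edges)
and the proper nonempty sets of vertices (cocycle vectors). -/
def cocycleMatrix : Matrix (G.edgeSet ⊕ ProperSubset V) G.Dart ℤ :=
  Matrix.of fun r a =>
    match r with
    | Sum.inl e => if a.edge = (e : Sym2 V) then 1 else 0
    | Sum.inr B => cocycleVector (B : Set V) a

end Graph

end

end KIdeal

/-!
An integer vector `z` on the darts lies in the kernel of the cocycle matrix exactly when it is
antisymmetric (`z` of a reversed dart is minus `z` of the dart) and a circulation (the net outflow
at every vertex vanishes). The whole theorem rests on one combinatorial fact,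
`IsCirculation.exists_isCycle`: a nonzero antisymmetric circulation is positive on all darts of some
cycle. Indeed, where a positive dart leaves a vertex, another one must enter it, so a path of
positive darts can be extended backwards until it closes up; antisymmetry prevents it from closing
up along a single edge.

* The vector of that cycle is conformal to `z`. Hence a Graver vector is the vector of a cycle.
  Conversely, a circulation supported on a cycle takes the same value on consecutive darts of the
  cycle, so it is a multiple of the vector of the cycle, which is therefore conformally minimal
  (`graverVectors_kernelLattice`).
* Two monomials with the same image under the monomial homomorphism differ by a vector `z` in the
  kernel. If they are distinct, the cycle found above divides one of them and its reversal divides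
  the other, so modulo the cycle binomials both can be reduced to smaller monomials. By induction
  the toric ideal is contained in the ideal of the cycle binomials (`toricIdeal_le_span`). The
  latter is contained in the K-ideal, which is contained in the toric ideal since closed walks are
  circulations.
-/

namespace KIdeal

open Classical SimpleGraph

/-! ### The monomial homomorphism of an integer matrix -/

section Toric

variable {σ ρ : Type*} (k : Type*) [CommRing k] (M : Matrix ρ σ ℤ)

/-- The sum of the columns of `M` indexed by the elements of a multiset, which is the exponent of
the Laurent monomial to which the monomial given by the multiset is mapped. -/
def columnSum (u : Multiset σ) : ρ → ℤ :=
  (u.map fun a r => M r a).sum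

/-- The monomial whose variables are listed, with multiplicity, by a multiset. -/
noncomputable def multisetMonomial (u : Multiset σ) : MvPolynomial σ k :=
  (u.map MvPolynomial.X).prod

theorem columnSum_add (u v : Multiset σ) : columnSum M (u + v) = columnSum M u + columnSum M v := by
  simp [columnSum]

theorem multisetMonomial_add (u v : Multiset σ) :
    multisetMonomial k (u + v) = multisetMonomial k u * multisetMonomial k v := by
  simp [multisetMonomial]

theorem monomialHom_multisetMonomial (u : Multiset σ) :
    monomialHom k M (multisetMonomial k u) = AddMonoidAlgebra.single (columnSum M u) 1 := by
  induction u using Multiset.induction_on with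
  | empty =>
    rw [multisetMonomial, Multiset.map_zero, Multiset.prod_zero, map_one]
    rfl
  | cons a u ih =>
    rw [← Multiset.singleton_add, multisetMonomial_add, map_mul, ih, columnSum_add]
    simp [multisetMonomial, columnSum, monomialHom, AddMonoidAlgebra.single_mul_single]

theorem multisetMonomial_eq_prod [Fintype σ] [DecidableEq σ] (u : Multiset σ) :
    multisetMonomial k u = ∏ a, MvPolynomial.X a ^ u.count a := by
  rw [multisetMonomial, Finset.prod_multiset_map_count]
  refine Finset.prod_subset (Finset.subset_univ _) fun a _ ha => ?_
  rw [Multiset.count_eq_zero_of_notMem (by simpa using ha), pow_zero]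

theorem columnSum_apply [Fintype σ] [DecidableEq σ] (u : Multiset σ) (r : ρ) :
    columnSum M u r = ∑ a, M r a * (u.count a : ℤ) := by
  induction u using Multiset.induction_on with
  | empty => simp [columnSum]
  | cons b u ih =>
    rw [← Multiset.singleton_add, columnSum_add, Pi.add_apply, ih]
    simp only [columnSum, Multiset.map_singleton, Multiset.sum_singleton, Multiset.count_add,
      Multiset.count_singleton, Nat.cast_add, mul_add, Finset.sum_add_distrib]
    simp

variable {k} in
theorem vectorBinomial_mem_toricIdeal [Fintype σ] [Nontrivial k] (z : σ → ℤ) :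
    vectorBinomial k z ∈ toricIdeal k M ↔ z ∈ kernelLattice M := by
  have hprod : ∀ n : σ → ℕ, ∃ u : Multiset σ, ∀ a, u.count a = n a := fun n =>
    ⟨Finsupp.toMultiset (Finsupp.equivFunOnFinite.symm n), fun a => by
      rw [Finsupp.count_toMultiset]; rfl⟩
  obtain ⟨u, hu⟩ := hprod fun a => (z a).toNat
  obtain ⟨v, hv⟩ := hprod fun a => (-(z a)).toNat
  have hz : vectorBinomial k z = multisetMonomial k u - multisetMonomial k v := by
    simp only [vectorBinomial, multisetMonomial_eq_prod, hu, hv]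
  rw [hz, toricIdeal, RingHom.mem_ker, map_sub, sub_eq_zero]
  change monomialHom k M _ = monomialHom k M _ ↔ _
  rw [monomialHom_multisetMonomial, monomialHom_multisetMonomial,
    AddMonoidAlgebra.single_left_inj one_ne_zero, kernelLattice, Set.mem_ofPred_eq, funext_iff,
    funext_iff]
  refine forall_congr' fun r => ?_
  rw [columnSum_apply, columnSum_apply, ← sub_eq_zero, ← Finset.sum_sub_distrib, Matrix.mulVec,
    dotProduct, Pi.zero_apply]
  have : ∀ a, M r a * (u.count a : ℤ) - M r a * (v.count a : ℤ) = M r a * z a := fun a => by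
    rw [hu, hv, ← mul_sub]
    congr 1
    omega
  simp only [this]

/-- The toric ideal is contained in every ideal that contains the differences of all monomials with
the same image: modulo such an ideal, a polynomial depends only on its image under the monomial
homomorphism. -/
theorem toricIdeal_le_of_multisetMonomial_sub_mem {I : Ideal (MvPolynomial σ k)}
    (h : ∀ u v : Multiset σ, columnSum M u = columnSum M v →
      multisetMonomial k u - multisetMonomial k v ∈ I) :
    toricIdeal k M ≤ I := by
  -- `L` maps a Laurent monomial to the class of a chosen preimage under the monomial homomorphism.
  let L : AddMonoidAlgebra k (ρ → ℤ) →ₗ[k] MvPolynomial σ k ⧸ I :=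
    Finsupp.linearCombination k
      (fun w => Ideal.Quotient.mk I (multisetMonomial k (Function.invFun (columnSum M) w))) ∘ₗ
      (AddMonoidAlgebra.coeffLinearEquiv k).toLinearMap
  have hL : L ∘ₗ (monomialHom k M).toLinearMap = (Ideal.Quotient.mkₐ k I).toLinearMap := by
    refine MvPolynomial.linearMap_ext fun s => LinearMap.ext_ring ?_
    have hs : MvPolynomial.monomial s (1 : k) = multisetMonomial k (Finsupp.toMultiset s) := by
      rw [MvPolynomial.monomial_eq, map_one, one_mul, multisetMonomial, Finsupp.toMultiset_map,
        Finsupp.prod_toMultiset, Finsupp.prod_mapDomain_index] <;> simp [pow_add]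
    simp only [LinearMap.comp_apply, hs, AlgHom.toLinearMap_apply, monomialHom_multisetMonomial]
    simp only [L, LinearMap.comp_apply, LinearEquiv.coe_coe]
    have := Function.invFun_eq (f := columnSum M) ⟨Finsupp.toMultiset s, rfl⟩
    simpa [Ideal.Quotient.mk_eq_mk_iff_sub_mem] using h _ _ this
  intro f hf
  have hf0 : monomialHom k M f = 0 := hf
  have := LinearMap.congr_fun hL f
  simp only [LinearMap.comp_apply, AlgHom.toLinearMap_apply, hf0, map_zero] at this
  exact Ideal.Quotient.eq_zero_iff_mem.mp this.symm

end Toric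

/-! ### Circulations and cycles -/

section Circulation

variable {V : Type*} {G : SimpleGraph V}

/-- An antisymmetric integer flow on the darts whose net outflow vanishes at every vertex. -/
def IsCirculation [Fintype V] [DecidableRel G.Adj] (z : G.Dart → ℤ) : Prop :=
  (∀ d, z d.symm = -z d) ∧ ∀ v, ∑ d with d.fst = v, z d = 0

/-- The vector of a walk: the number of its passages through a dart minus the number of its passages
through the reversed dart. -/
noncomputable def walkVector {u v : V} (ω : G.Walk u v) (d : G.Dart) : ℤ :=
  (ω.darts.count d : ℤ) - ω.darts.count d.symm

theorem symm_notMem_darts {u v : V} {ω : G.Walk u v} (h : ω.IsTrail) {d : G.Dart}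
    (hd : d ∈ ω.darts) : d.symm ∉ ω.darts := fun hs =>
  d.symm_ne (List.inj_on_of_nodup_map h.edges_nodup hs hd d.edge_symm)

theorem darts_nodup_of_isTrail {u v : V} {ω : G.Walk u v} (h : ω.IsTrail) : ω.darts.Nodup :=
  List.Nodup.of_map _ h.edges_nodup

theorem walkVector_of_mem {u v : V} {ω : G.Walk u v} (h : ω.IsTrail) {d : G.Dart}
    (hd : d ∈ ω.darts) : walkVector ω d = 1 := by
  rw [walkVector, List.count_eq_one_of_mem (darts_nodup_of_isTrail h) hd,
    List.count_eq_zero_of_not_mem (symm_notMem_darts h hd)]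
  rfl

theorem walkVector_symm {u v : V} (ω : G.Walk u v) (d : G.Dart) :
    walkVector ω d.symm = -walkVector ω d := by
  simp [walkVector]

theorem walkVector_of_notMem {u v : V} {ω : G.Walk u v} {d : G.Dart}
    (hd : d ∉ ω.darts) (hs : d.symm ∉ ω.darts) : walkVector ω d = 0 := by
  simp [walkVector, List.count_eq_zero_of_not_mem hd, List.count_eq_zero_of_not_mem hs]

theorem count_darts_reverse {u v : V} (ω : G.Walk u v) (d : G.Dart) :
    ω.reverse.darts.count d = ω.darts.count d.symm := by
  rw [Walk.darts_reverse, List.count_reverse]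
  conv_lhs => rw [← d.symm_symm]
  exact List.count_map_of_injective _ _ Dart.symm_involutive.injective _

theorem walkVector_ne_zero {v : V} {ω : G.Walk v v} (h : ω.IsCycle) : walkVector ω ≠ 0 := by
  intro h0
  have hlen : 0 < ω.darts.length := by
    have := h.three_le_length
    rw [Walk.length_darts]
    omega
  have := walkVector_of_mem h.isTrail (List.getElem_mem hlen)
  rw [h0] at this
  exact zero_ne_one this

theorem vectorBinomial_walkVector (k : Type*) [CommRing k] [Fintype V] [DecidableRel G.Adj] {v : V}
    {ω : G.Walk v v} (h : ω.IsTrail) : vectorBinomial k (walkVector ω) = walkBinomial k ω := by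
  have hm : ∀ {u v : V} (ω : G.Walk u v),
      walkMonomial k ω = ∏ a, MvPolynomial.X a ^ ω.darts.count a := fun ω => by
    simpa [multisetMonomial, walkMonomial] using
      multisetMonomial_eq_prod k (ω.darts : Multiset G.Dart)
  have h0 : ∀ d, ω.darts.count d = 0 ∨ ω.darts.count d.symm = 0 := fun d => by
    by_cases hd : d ∈ ω.darts
    · exact Or.inr (List.count_eq_zero_of_not_mem (symm_notMem_darts h hd))
    · exact Or.inl (List.count_eq_zero_of_not_mem hd)
  rw [walkBinomial, hm, hm, vectorBinomial]
  congr 1 <;> refine Finset.prod_congr rfl fun d _ => ?_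
  · congr 1
    have := h0 d
    simp only [walkVector]
    omega
  · rw [count_darts_reverse]
    congr 1
    have := h0 d
    simp only [walkVector]
    omega

theorem conformal_walkVector {v : V} {ω : G.Walk v v} (h : ω.IsTrail) {z : G.Dart → ℤ}
    (hz : ∀ d, z d.symm = -z d) (hpos : ∀ d ∈ ω.darts, 0 < z d) : Conformal (walkVector ω) z := by
  intro d
  by_cases hd : d ∈ ω.darts
  · have := hpos d hd
    rw [walkVector_of_mem h hd, abs_one, abs_of_pos this]
    omega
  · by_cases hs : d.symm ∈ ω.darts
    · have h1 := hpos _ hs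
      have h2 := walkVector_of_mem h hs
      rw [hz] at h1
      rw [walkVector_symm] at h2
      rw [show walkVector ω d = -1 by omega, abs_of_neg (show z d < 0 by omega)]
      simp only [abs_neg, abs_one]
      omega
    · rw [walkVector_of_notMem hd hs]
      simp

variable [Fintype V] [DecidableRel G.Adj]

theorem IsCirculation.exists_pos_snd {z : G.Dart → ℤ} (hz : IsCirculation z) {d : G.Dart}
    (hd : 0 < z d) : ∃ e : G.Dart, e.snd = d.fst ∧ 0 < z e := by
  have hneg : ∃ e ∈ Finset.univ.filter (fun e : G.Dart => e.fst = d.fst), z e < 0 := by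
    by_contra! hcon
    have := (Finset.sum_eq_zero_iff_of_nonneg hcon).mp (hz.2 d.fst) d (by simp)
    omega
  obtain ⟨e, he, hlt⟩ := hneg
  refine ⟨e.symm, by simpa using he, ?_⟩
  rw [hz.1]
  omega

/-- A path of positive darts extends backwards until it closes up to a cycle of positive darts.
The number `n` bounds how often the path can still be extended. -/
theorem IsCirculation.exists_isCycle_of_path {z : G.Dart → ℤ} (hz : IsCirculation z) (n : ℕ) :
    ∀ {w v : V} (p : G.Walk w v), p.IsPath → (∀ d ∈ p.darts, 0 < z d) →
      (∃ d : G.Dart, d.snd = w ∧ 0 < z d) → Fintype.card V ≤ p.length + n →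
      ∃ (x : V) (ω : G.Walk x x), ω.IsCycle ∧ ∀ d ∈ ω.darts, 0 < z d := by
  induction n with
  | zero =>
    intro w v p hp _ _ hlen
    have := hp.length_lt
    omega
  | succ n ih =>
    rintro w v p hp hpos ⟨d, rfl, hd⟩ hlen
    by_cases hx : d.fst ∈ p.support
    · refine ⟨d.fst, Walk.cons d.adj (p.takeUntil d.fst hx), ?_, ?_⟩
      · have hq : (p.takeUntil d.fst hx).IsPath := hp.takeUntil hx
        have hqpos : ∀ e ∈ (p.takeUntil d.fst hx).darts, 0 < z e := fun e he =>
          hpos e (p.darts_takeUntil_subset_darts hx he)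
        generalize p.takeUntil d.fst hx = q at hq hqpos
        rw [Walk.cons_isCycle_iff]
        refine ⟨hq, fun hmem => ?_⟩
        obtain ⟨e, he, hed⟩ := List.mem_map.mp hmem
        have hed' : e.edge = d.edge := hed
        rcases (dart_edge_eq_iff e d).mp hed' with rfl | rfl
        · -- A path does not return to its initial vertex.
          have hsnd : e.snd ∈ q.support.tail := by
            rw [← Walk.map_snd_darts]
            exact List.mem_map_of_mem he
          have hnd := hq.support_nodup
          rw [← Walk.cons_tail_support] at hnd
          exact (List.nodup_cons.mp hnd).1 hsnd
        · have := hqpos _ he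
          rw [hz.1] at this
          omega
      · intro e he
        rw [Walk.darts_cons, List.mem_cons] at he
        rcases he with rfl | he
        · exact hd
        · exact hpos e (p.darts_takeUntil_subset_darts hx he)
    · refine ih (Walk.cons d.adj p) (hp.cons hx) ?_ (hz.exists_pos_snd hd) ?_
      · intro e he
        rw [Walk.darts_cons, List.mem_cons] at he
        rcases he with rfl | he
        · exact hd
        · exact hpos e he
      · rw [Walk.length_cons]
        omega

theorem IsCirculation.exists_isCycle {z : G.Dart → ℤ} (hz : IsCirculation z) (h0 : z ≠ 0) :
    ∃ (x : V) (ω : G.Walk x x), ω.IsCycle ∧ ∀ d ∈ ω.darts, 0 < z d := by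
  obtain ⟨d, hd⟩ : ∃ d, 0 < z d := by
    obtain ⟨d, hd⟩ := Function.ne_iff.mp h0
    rcases lt_or_gt_of_ne hd with h | h
    · refine ⟨d.symm, ?_⟩
      rw [hz.1]
      simpa using h
    · exact ⟨d, h⟩
  exact hz.exists_isCycle_of_path (Fintype.card V) (Walk.nil : G.Walk d.snd d.snd) Walk.IsPath.nil
    (by simp) ⟨d, rfl, hd⟩ (by simp)

/-- A circulation supported on a cycle takes the same value on all darts of the cycle, because the
flow entering a vertex of the cycle can leave it only through the next dart. -/
theorem IsCirculation.eq_of_mem_darts {z : G.Dart → ℤ} (hz : IsCirculation z) {x : V}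
    {ω : G.Walk x x} (h : ω.IsCycle) (hsupp : ∀ d, d ∉ ω.darts → d.symm ∉ ω.darts → z d = 0)
    {d e : G.Dart} (hd : d ∈ ω.darts) (he : e ∈ ω.darts) : z d = z e := by
  have hsnd : (ω.darts.map (·.snd)).Nodup := by
    rw [Walk.map_snd_darts]
    exact h.support_nodup
  have hfst : (ω.darts.map (·.fst)).Nodup := by
    have hr := h.reverse.support_nodup
    rw [← Walk.map_snd_darts, Walk.darts_reverse, List.map_reverse, List.nodup_reverse,
      List.map_map] at hr
    exact hr
  have hstep : ∀ d ∈ ω.darts, ∀ e ∈ ω.darts, d.snd = e.fst → z d = z e := by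
    intro d hd e he hde
    have hne : e ≠ d.symm := fun hed => symm_notMem_darts h.isTrail hd (hed ▸ he)
    have hsum := hz.2 e.fst
    rw [Finset.sum_eq_add_of_mem e d.symm (by simp) (by simpa using hde) hne, hz.1] at hsum
    · omega
    · rintro c hc ⟨hce, hcd⟩
      have hc' : c.fst = e.fst := by simpa using hc
      refine hsupp c (fun hm => hce (List.inj_on_of_nodup_map hfst hm he hc')) fun hm => hcd ?_
      rw [← c.symm_symm, List.inj_on_of_nodup_map hsnd hm hd (hc'.trans hde.symm)]
  have hchain : List.IsChain (fun d e => z d = z e) ω.darts :=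
    ω.isChain_dartAdj_darts.imp_of_mem_imp fun d e hd he hde => hstep d hd e he hde
  have : Trans (fun d e => z d = z e) (fun d e => z d = z e) (fun d e : G.Dart => z d = z e) :=
    ⟨Eq.trans⟩
  have : Std.Symm (fun d e : G.Dart => z d = z e) := ⟨fun _ _ => Eq.symm⟩
  exact (List.isChain_iff_pairwise.mp hchain).forall_of_forall
    (R := fun d e => z d = z e) (fun _ _ => rfl) hd he

end Circulation

/-! ### The kernel of the cocycle matrix -/

section Kernel

variable {V : Type*} {G : SimpleGraph V}

theorem sum_cocycleVector_darts (B : Set V) {u v : V} (ω : G.Walk u v) :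
    (ω.darts.map (cocycleVector B)).sum = (if u ∈ B then 1 else 0) - (if v ∈ B then 1 else 0) := by
  induction ω with
  | nil => simp
  | @cons u v w huv p ih =>
    rw [Walk.darts_cons, List.map_cons, List.sum_cons, ih]
    simp only [cocycleVector]
    split_ifs <;> simp_all

theorem columnSum_darts_reverse {v : V} (ω : G.Walk v v) :
    columnSum (cocycleMatrix G) (ω.reverse.darts : Multiset G.Dart) =
      columnSum (cocycleMatrix G) (ω.darts : Multiset G.Dart) := by
  have happ : ∀ (l : List G.Dart) r, columnSum (cocycleMatrix G) (l : Multiset G.Dart) r =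
      (l.map (cocycleMatrix G r)).sum := fun l r => by
    induction l with
    | nil => simp [columnSum]
    | cons a l ih =>
      rw [← Multiset.cons_coe, ← Multiset.singleton_add, columnSum_add, Pi.add_apply, ih]
      simp [columnSum]
  funext r
  rw [happ, happ]
  rcases r with e | B
  · rw [Walk.darts_reverse, List.map_reverse, List.sum_reverse, List.map_map]
    congr 2
    funext d
    simp [cocycleMatrix]
  · have h := fun p : G.Walk v v => sum_cocycleVector_darts (B : Set V) p
    simp only [sub_self] at h
    exact (h ω.reverse).trans (h ω).symm

variable [Fintype V] [DecidableRel G.Adj]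

theorem isCirculation_of_mem_kernelLattice {z : G.Dart → ℤ}
    (hz : z ∈ kernelLattice (cocycleMatrix G)) : IsCirculation z := by
  have hrow : ∀ r, ∑ d, cocycleMatrix G r d * z d = 0 := fun r => congrFun hz r
  have hsymm : ∀ d, z d.symm = -z d := fun d => by
    have h := hrow (Sum.inl ⟨d.edge, d.edge_mem⟩)
    rw [Finset.sum_eq_add_of_mem d d.symm (Finset.mem_univ _) (Finset.mem_univ _) d.symm_ne.symm]
      at h
    · simp [cocycleMatrix] at h
      omega
    · rintro c - ⟨hcd, hcs⟩
      have : c.edge ≠ d.edge := fun hc => ((dart_edge_eq_iff c d).mp hc).elim hcd hcs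
      simp [cocycleMatrix, this]
  refine ⟨hsymm, fun v => ?_⟩
  -- If `v` is the only vertex, then `{v}` is not a row of the matrix, but there are no darts.
  by_cases hv : ({v} : Set V) = Set.univ
  · refine Finset.sum_eq_zero fun d _ => (d.adj.ne ?_).elim
    have h : ∀ w, w = v := fun w => (hv ▸ Set.mem_univ w : w ∈ ({v} : Set V))
    rw [h d.fst, h d.snd]
  · have h := hrow (Sum.inr ⟨{v}, Set.singleton_nonempty v, hv⟩)
    -- By antisymmetry, the row of `{v}` counts the net outflow at `v` twice.
    let g : G.Dart → ℤ := fun d => if d.fst = v then z d else 0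
    have hterm : ∀ d : G.Dart, cocycleMatrix G (Sum.inr ⟨{v}, Set.singleton_nonempty v, hv⟩) d * z d
        = g d + g d.symm := fun d => by
      have hne := d.adj.ne
      change _ = (if d.fst = v then z d else 0) + (if d.snd = v then z d.symm else 0)
      rw [hsymm]
      simp only [cocycleMatrix, Matrix.of_apply, cocycleVector, Set.mem_singleton_iff]
      split_ifs <;> simp_all
    have hcomp : ∑ d : G.Dart, g d.symm = ∑ d, g d :=
      Equiv.sum_comp (Dart.symm_involutive (G := G)).toPerm g
    simp only [hterm, Finset.sum_add_distrib, hcomp] at h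
    rw [Finset.sum_filter]
    change ∑ d, g d = 0
    omega

theorem count_sub_count_mem_kernelLattice {σ ρ : Type*} [Fintype σ] [DecidableEq σ]
    {M : Matrix ρ σ ℤ}
    {u v : Multiset σ} (h : columnSum M u = columnSum M v) :
    (fun a => (u.count a : ℤ) - v.count a) ∈ kernelLattice M := by
  funext r
  have := congrFun h r
  rw [columnSum_apply, columnSum_apply, ← sub_eq_zero, ← Finset.sum_sub_distrib] at this
  simpa only [Matrix.mulVec, dotProduct, mul_sub, Pi.zero_apply] using this

theorem walkVector_mem_kernelLattice {v : V} (ω : G.Walk v v) :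
    walkVector ω ∈ kernelLattice (cocycleMatrix G) := by
  have := count_sub_count_mem_kernelLattice (columnSum_darts_reverse ω).symm
  simp only [Multiset.coe_count, count_darts_reverse] at this
  exact this

/-- Every nonzero kernel vector dominates the vector of a cycle, and a kernel vector dominated by the
vector of a cycle is `0` or equal to it. -/
theorem graverVectors_kernelLattice :
    graverVectors (kernelLattice (cocycleMatrix G)) =
      {z | ∃ (v : V) (ω : G.Walk v v), ω.IsCycle ∧ z = walkVector ω} := by
  ext z
  constructor
  · rintro ⟨hz, h0, hmin⟩
    have hc := isCirculation_of_mem_kernelLattice hz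
    obtain ⟨v, ω, hω, hpos⟩ := hc.exists_isCycle h0
    exact ⟨v, ω, hω, (hmin _ (walkVector_mem_kernelLattice ω) (walkVector_ne_zero hω)
      (conformal_walkVector hω.isTrail hc.1 hpos)).symm⟩
  · rintro ⟨v, ω, hω, rfl⟩
    refine ⟨walkVector_mem_kernelLattice ω, walkVector_ne_zero hω, fun z hz h0 hconf => ?_⟩
    have hc := isCirculation_of_mem_kernelLattice hz
    have hsupp : ∀ d, d ∉ ω.darts → d.symm ∉ ω.darts → z d = 0 := fun d hd hs => by
      have := (hconf d).2
      rw [walkVector_of_notMem hd hs, abs_zero] at this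
      exact abs_nonpos_iff.mp this
    have hval : ∀ d ∈ ω.darts, 0 ≤ z d ∧ z d ≤ 1 := fun d hd => by
      have := hconf d
      rw [walkVector_of_mem hω.isTrail hd, mul_one, abs_one] at this
      exact ⟨this.1, (le_abs_self _).trans this.2⟩
    -- The common value of `z` on the darts of the cycle is not `0`, so it is `1`.
    have hone : ∀ d ∈ ω.darts, z d = 1 := by
      by_contra! hcon
      obtain ⟨d, hd, hd1⟩ := hcon
      have hd0 : ∀ e ∈ ω.darts, z e = 0 := fun e he => by
        have := hval d hd
        rw [hc.eq_of_mem_darts hω hsupp he hd]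
        omega
      refine h0 (funext fun e => ?_)
      by_cases he : e ∈ ω.darts
      · exact hd0 e he
      · by_cases hs : e.symm ∈ ω.darts
        · have := hd0 _ hs
          rwa [hc.1, neg_eq_zero] at this
        · exact hsupp e he hs
    funext d
    by_cases hd : d ∈ ω.darts
    · rw [hone d hd, walkVector_of_mem hω.isTrail hd]
    · by_cases hs : d.symm ∈ ω.darts
      · have h1 := hone _ hs
        rw [← walkVector_of_mem hω.isTrail hs, walkVector_symm, hc.1] at h1
        exact neg_injective h1
      · rw [hsupp d hd hs, walkVector_of_notMem hd hs]

theorem cycleBinomials_eq_image (k : Type*) [CommRing k] :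
    cycleBinomials k G =
      vectorBinomial k '' graverVectors (kernelLattice (cocycleMatrix G)) := by
  rw [graverVectors_kernelLattice]
  ext f
  constructor
  · rintro ⟨v, ω, hω, rfl⟩
    exact ⟨_, ⟨v, ω, hω, rfl⟩, vectorBinomial_walkVector k hω.isTrail⟩
  · rintro ⟨_, ⟨v, ω, hω, rfl⟩, rfl⟩
    exact ⟨v, ω, hω, vectorBinomial_walkVector k hω.isTrail⟩

end Kernel

/-! ### Equality of the ideals -/

section Ideals

variable {V : Type*} (k : Type*) [CommRing k] (G : SimpleGraph V)

theorem kIdeal_le_toricIdeal : kIdeal k G ≤ toricIdeal k (cocycleMatrix G) := by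
  rw [kIdeal, Ideal.span_le]
  rintro _ ⟨v, ω, rfl⟩
  have hm : ∀ p : G.Walk v v,
      walkMonomial k p = multisetMonomial k (p.darts : Multiset G.Dart) := fun p => by
    simp [walkMonomial, multisetMonomial]
  change monomialHom k _ _ = 0
  rw [walkBinomial, map_sub, hm, hm, monomialHom_multisetMonomial, monomialHom_multisetMonomial,
    columnSum_darts_reverse, sub_self]

theorem span_cycleBinomials_le_kIdeal : Ideal.span (cycleBinomials k G) ≤ kIdeal k G :=
  Ideal.span_mono fun _ ⟨v, ω, _, hf⟩ => ⟨v, ω, hf⟩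

variable {G} [Fintype V] [DecidableRel G.Adj]

/-- If two monomials with the same image differ, there is a cycle that divides the first and whose
reversal divides the second; removing both changes the difference by a multiple of the cycle
binomial. -/
theorem multisetMonomial_sub_mem_span (u v : Multiset G.Dart)
    (h : columnSum (cocycleMatrix G) u = columnSum (cocycleMatrix G) v) :
    multisetMonomial k u - multisetMonomial k v ∈ Ideal.span (cycleBinomials k G) := by
  induction hn : u.card using Nat.strong_induction_on generalizing u v with
  | _ n ih =>
  have hz := isCirculation_of_mem_kernelLattice (count_sub_count_mem_kernelLattice h)
  by_cases h0 : (fun a => (u.count a : ℤ) - v.count a) = 0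
  · have huv : u = v := Multiset.ext.mpr fun a => by
      have := congrFun h0 a
      simp only [Pi.zero_apply] at this
      omega
    rw [huv, sub_self]
    exact zero_mem _
  · obtain ⟨x, ω, hω, hpos⟩ := hz.exists_isCycle h0
    have hle : ((ω.darts : Multiset G.Dart)) ≤ u := by
      rw [Multiset.le_iff_subset (Multiset.coe_nodup.mpr (darts_nodup_of_isTrail hω.isTrail))]
      intro d hd
      have : 0 < (u.count d : ℤ) - v.count d := hpos d hd
      exact Multiset.count_pos.mp (by omega)
    have hle' : ((ω.reverse.darts : Multiset G.Dart)) ≤ v := by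
      rw [Multiset.le_iff_subset (Multiset.coe_nodup.mpr
        (darts_nodup_of_isTrail hω.isTrail.reverse))]
      intro d hd
      have h1 := hpos _ (Walk.mem_darts_reverse.mp hd)
      have h2 := hz.1 d
      simp only at h1 h2
      exact Multiset.count_pos.mp (by omega)
    obtain ⟨u', rfl⟩ := Multiset.le_iff_exists_add.mp hle
    obtain ⟨v', rfl⟩ := Multiset.le_iff_exists_add.mp hle'
    rw [columnSum_add, columnSum_add, columnSum_darts_reverse, add_right_inj] at h
    have hcard : u'.card < n := by
      have := hω.three_le_length
      rw [← hn, Multiset.card_add, Multiset.coe_card, Walk.length_darts]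
      omega
    have hrec := ih _ hcard u' v' h rfl
    have hcyc : multisetMonomial k (ω.darts : Multiset G.Dart) -
        multisetMonomial k (ω.reverse.darts : Multiset G.Dart) ∈
          Ideal.span (cycleBinomials k G) := by
      refine Ideal.subset_span ⟨x, ω, hω, ?_⟩
      simp [walkBinomial, walkMonomial, multisetMonomial]
    rw [multisetMonomial_add, multisetMonomial_add]
    convert add_mem (Ideal.mul_mem_left _ (multisetMonomial k u') hcyc)
      (Ideal.mul_mem_left _ (multisetMonomial k (ω.reverse.darts : Multiset G.Dart)) hrec) using 1
    ring

theorem toricIdeal_le_span :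
    toricIdeal k (cocycleMatrix G) ≤ Ideal.span (cycleBinomials k G) :=
  toricIdeal_le_of_multisetMonomial_sub_mem k _ (multisetMonomial_sub_mem_span k)

end Ideals

end KIdeal

theorem mainTheorem1 {V : Type*} [Fintype V] (G : SimpleGraph V) [DecidableRel G.Adj]
    (hG : G.Connected) (k : Type*) [Field k] :
    KIdeal.kIdeal k G = KIdeal.toricIdeal k (KIdeal.cocycleMatrix G) ∧
    KIdeal.kIdeal k G = Ideal.span (KIdeal.cycleBinomials k G) ∧
    KIdeal.cycleBinomials k G = KIdeal.graverBasis (KIdeal.kIdeal k G) ∧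
    KIdeal.cycleBinomials k G =
      KIdeal.vectorBinomial k ''
        KIdeal.graverVectors (KIdeal.kernelLattice (KIdeal.cocycleMatrix G)) := by
  have h1 := KIdeal.kIdeal_le_toricIdeal k G
  have h2 := KIdeal.toricIdeal_le_span k (G := G)
  have h3 := KIdeal.span_cycleBinomials_le_kIdeal k G
  have htoric := le_antisymm h1 (h2.trans h3)
  have hgraver := KIdeal.cycleBinomials_eq_image (G := G) k
  refine ⟨htoric, le_antisymm (h1.trans h2) h3, ?_, hgraver⟩
  rw [hgraver, KIdeal.graverBasis, htoric]
  simp only [KIdeal.vectorBinomial_mem_toricIdeal, Set.ofPred_mem_eq]
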